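/- Conventions. Compositions are written from left to right. A semigroup $S$ (possibly empty) is regular if for each $a\in S$ there is $x\in S$ with $axa=a$; $a\leqslant_r b$ means $a\in bS$, $\mathscr R$ is the induced equivalence, and $S/\mathscr R$ is partially ordered by $R_a\sqsubseteq R_b\iff a\leqslant_r b$. A category with subobjects is a small category $\mathcal C$ with a subcategory $\mathcal P$ having the same objects, whose morphisms are called inclusions, such that: $\mathcal P$ is a strict preorder (at most one morphism between any two objects, and only identities are isomorphisms); every inclusion is a monomorphism of $\mathcal C$; and if $f=hg$ with $f,g\in\mathcal P$ and $h\in\mathcal C$, then $h\in\mathcal P$. A retraction is a morphism $q$ with $jq=1$ for some inclusion $j$. A cone with vertex $z$ is a family of morphisms $\gamma(c)\colon c\to z$, one for each object $c$, with $j\,\gamma(b)=\gamma(a)$ for every inclusion $j\colon a\to b$, and with at least one component an isomorphism. $\mathcal C$ is a normal category if every inclusion $j$ has some $q$ with $jq=1$, every morphism is of the form $quj$ with $q$ a retraction, $u$ an isomorphism and $j$ an inclusion, and for every object $c$ there is a cone $\mu$ with vertex $c$ and $\mu(c)=1_c$. In a normal category the morphism $f^\circ:=qu$ depends only on $f=quj$,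 and the set $\widehat{\mathcal C}$ of all cones is a regular semigroup under $(\gamma\cdot\delta)(c)=\gamma(c)\,(\delta(z_\gamma))^\circ$, where $z_\gamma$ is the vertex of $\gamma$. An object $c$ is connected by $\mathfrak d\in\widehat{\mathcal C}/\mathscr R$ if $\mathfrak d$ contains an idempotent cone with vertex $c$; this cone is then unique and is denoted by $\epsilon(c,\mathfrak d)$. A CC-morphism from a normal category $\mathcal C$ to a normal category $\mathcal C'$ is a pair $(F,G)$, where $F\colon\mathcal C\to\mathcal C'$ is an inclusion-preserving functor and $G\colon\widehat{\mathcal C}/\mathscr R\to\widehat{\mathcal C'}/\mathscr R$ is an order-preserving map, such that whenever $c$ is connected by $\mathfrak d$, $F(c)$ is connected by $G(\mathfrak d)$ and $F(\epsilon(c,\mathfrak d)(c'))=\epsilon(F(c),G(\mathfrak d))(F(c'))$ for every object $c'$ of $\mathcal C$. For a regular semigroup $S$, let $\mathbb L(S)$ be the category whose objects are the left ideals $Se$ ($e\in S$ idempotent) and whose morphisms from $Se$ to $Sf$ are the maps $x\mapsto xu$ with $u\in eSf$; with the set inclusions as inclusions it is a normal category. $S$ is totally left reductive if it is regular and isomorphic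 to the semigroup $\widehat{\mathbb L(S)}$ of all cones in $\mathbb L(S)$. Theorem. The category of normal categories, with CC-morphisms, is equivalent to the category of totally left reductive semigroups, with semigroup homomorphisms. -/

import Mathlib

open CategoryTheory

universe u

namespace ConnCat

/-! ### Regular semigroups, the right quasi-order and R-classes -/

/-- A semigroup is (von Neumann) regular if every `a` has some `x` with `a x a = a`. -/
class RegularSemigroup (S : Type u) [Semigroup S] : Prop where
  regular : ∀ a : S, ∃ x : S, a * x * a = a

/-- The quasi-order `a ≤_r b ↔ a ∈ bS`. -/
def RightLE {S : Type u} [Semigroup S] (a b : S) : Prop := ∃ x : S, a = b * x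

theorem RightLE.refl {S : Type u} [Semigroup S] [RegularSemigroup S] (a : S) : RightLE a a := by
  obtain ⟨x, hx⟩ := RegularSemigroup.regular a
  exact ⟨x * a, by rw [← mul_assoc, hx]⟩

theorem RightLE.trans {S : Type u} [Semigroup S] {a b c : S} (h : RightLE a b)
    (h' : RightLE b c) : RightLE a c := by
  obtain ⟨x, rfl⟩ := h
  obtain ⟨y, rfl⟩ := h'
  exact ⟨y * x, mul_assoc _ _ _⟩

/-- Green's relation R on a regular semigroup. -/
def greenR (S : Type u) [Semigroup S] [RegularSemigroup S] : Setoid S where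
  r a b := RightLE a b ∧ RightLE b a
  iseqv :=
    { refl := fun a => ⟨RightLE.refl a, RightLE.refl a⟩
      symm := fun h => ⟨h.2, h.1⟩
      trans := fun h k => ⟨h.1.trans k.1, k.2.trans h.2⟩ }

/-- The set `S/R` of R-classes of a regular semigroup. -/
def RClass (S : Type u) [Semigroup S] [RegularSemigroup S] : Type u := Quotient (greenR S)

/-- The R-class of an element. -/
def rClass {S : Type u} [Semigroup S] [RegularSemigroup S] (a : S) : RClass S :=
  Quotient.mk (greenR S) a

/-- The partial order `R_a ⊑ R_b ↔ a ≤_r b` on `S/R`. -/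
instance (S : Type u) [Semigroup S] [RegularSemigroup S] : PartialOrder (RClass S) where
  le := Quotient.lift₂ (fun a b : S => RightLE a b) (fun _ _ _ _ h k =>
    propext ⟨fun t => (h.2.trans t).trans k.1, fun t => (h.1.trans t).trans k.2⟩)
  le_refl := by
    rintro ⟨a⟩
    exact RightLE.refl a
  le_trans := by
    rintro ⟨a⟩ ⟨b⟩ ⟨c⟩ h k
    exact RightLE.trans h k
  le_antisymm := by
    rintro ⟨a⟩ ⟨b⟩ h k
    exact Quotient.sound ⟨h, k⟩

/-! ### Categories with subobjects and normal categories -/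

/-- A small category with a distinguished wide subcategory (its morphisms are the inclusions)
that is a strict preorder, such that inclusions are monomorphisms and `h ≫ g = f` with `f`, `g`
inclusions forces `h` to be an inclusion. -/
class CategoryWithSubobjects (C : Type u) [SmallCategory C] where
  incl : MorphismProperty C
  incl_id : ∀ a : C, incl (𝟙 a)
  incl_comp : ∀ {a b c : C} (f : a ⟶ b) (g : b ⟶ c), incl f → incl g → incl (f ≫ g)
  incl_unique : ∀ {a b : C} (f g : a ⟶ b), incl f → incl g → f = g
  incl_antisymm : ∀ {a b : C} (f : a ⟶ b) (g : b ⟶ a), incl f → incl g → a = b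
  incl_mono : ∀ {a b : C} (f : a ⟶ b), incl f → Mono f
  incl_of_comp : ∀ {a b c : C} (h : a ⟶ b) (g : b ⟶ c), incl g → incl (h ≫ g) → incl h

open CategoryWithSubobjects

section

variable {C : Type u} [SmallCategory C] [CategoryWithSubobjects C]

/-- A retraction: a right inverse (in the order of composition) of an inclusion. -/
def IsRetraction {b a : C} (q : b ⟶ a) : Prop := ∃ j : a ⟶ b, incl j ∧ j ≫ q = 𝟙 a

variable (C) in
/-- A cone with vertex `z`. -/
@[ext]
structure ConeAt (z : C) where
  app : ∀ c : C, c ⟶ z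
  incl_app : ∀ {a b : C} (j : a ⟶ b), incl j → j ≫ app b = app a
  exists_isIso : ∃ c : C, IsIso (app c)

variable (C) in
/-- The set of all cones in `C`, with arbitrary vertices. -/
structure Cones where
  vertex : C
  cone : ConeAt C vertex

end

/-- A normal category. -/
class NormalCategory (C : Type u) [SmallCategory C] extends CategoryWithSubobjects C where
  incl_splits : ∀ {a b : C} (j : a ⟶ b), incl j → ∃ q : b ⟶ a, j ≫ q = 𝟙 a
  normal_factorisation : ∀ {a b : C} (f : a ⟶ b), ∃ (a' b' : C) (q : a ⟶ a') (v : a' ⟶ b')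
    (j : b' ⟶ b), IsRetraction q ∧ IsIso v ∧ incl j ∧ f = q ≫ v ≫ j
  exists_cone : ∀ c : C, ∃ μ : ConeAt C c, μ.app c = 𝟙 c

/-! ### The semigroup of cones -/

section

variable {C : Type u} [SmallCategory C] [NormalCategory C]

/-- A composite of a retraction followed by an isomorphism. -/
def IsNormalEpi {a b : C} (p : a ⟶ b) : Prop :=
  ∃ (a' : C) (q : a ⟶ a') (v : a' ⟶ b), IsRetraction q ∧ IsIso v ∧ p = q ≫ v

theorem IsNormalEpi.exists_section {a b : C} {p : a ⟶ b} (h : IsNormalEpi p) :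
    ∃ i : b ⟶ a, i ≫ p = 𝟙 b := by
  obtain ⟨a', q, v, ⟨j, -, hj⟩, hv, rfl⟩ := h
  exact ⟨inv v ≫ j, by simp [reassoc_of% hj]⟩

theorem IsNormalEpi.epi {a b : C} {p : a ⟶ b} (h : IsNormalEpi p) : Epi p := by
  obtain ⟨i, hi⟩ := h.exists_section
  have : IsSplitEpi p := ⟨⟨⟨i, hi⟩⟩⟩
  infer_instance

theorem IsNormalEpi.of_isIso {a b : C} (p : a ⟶ b) [IsIso p] : IsNormalEpi p :=
  ⟨a, 𝟙 a, p, ⟨𝟙 a, incl_id a, by simp⟩, inferInstance, by simp⟩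

theorem IsNormalEpi.of_epi {a b : C} (p : a ⟶ b) [Epi p] : IsNormalEpi p := by
  obtain ⟨a', b', q, v, j, hq, hv, hj, rfl⟩ := NormalCategory.normal_factorisation p
  have hm : Mono j := incl_mono j hj
  have he : Epi j := by
    have : Epi ((q ≫ v) ≫ j) := by simpa using (inferInstance : Epi (q ≫ v ≫ j))
    exact epi_of_epi (q ≫ v) j
  obtain ⟨r, hr⟩ := NormalCategory.incl_splits j hj
  have : IsSplitMono j := ⟨⟨⟨r, hr⟩⟩⟩
  have : IsIso j := isIso_of_epi_of_isSplitMono j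
  exact ⟨a', q, v ≫ j, hq, inferInstance, rfl⟩

theorem IsNormalEpi.comp {a b c : C} {p : a ⟶ b} {q : b ⟶ c} (hp : IsNormalEpi p)
    (hq : IsNormalEpi q) : IsNormalEpi (p ≫ q) := by
  have := hp.epi
  have := hq.epi
  have : Epi (p ≫ q) := epi_comp p q
  exact IsNormalEpi.of_epi _

/-- The factorisation `f = p ≫ j` is canonical: `p` is a retraction followed by an isomorphism
and `j` is an inclusion. -/
def IsCanonical {a b z : C} (f : a ⟶ b) (p : a ⟶ z) (j : z ⟶ b) : Prop :=
  IsNormalEpi p ∧ incl j ∧ f = p ≫ j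

theorem exists_canonical {a b : C} (f : a ⟶ b) :
    ∃ (z : C) (p : a ⟶ z) (j : z ⟶ b), IsCanonical f p j := by
  obtain ⟨a', b', q, v, j, hq, hv, hj, rfl⟩ := NormalCategory.normal_factorisation f
  exact ⟨b', q ≫ v, j, ⟨a', q, v, hq, hv, rfl⟩, hj, by simp⟩

theorem canonical_unique {a b z z' : C} {f : a ⟶ b} {p : a ⟶ z} {j : z ⟶ b} {p' : a ⟶ z'}
    {j' : z' ⟶ b} (h : IsCanonical f p j) (h' : IsCanonical f p' j') :
    z = z' ∧ HEq p p' := by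
  obtain ⟨hp, hj, rfl⟩ := h
  obtain ⟨hp', hj', e⟩ := h'
  obtain ⟨i, hi⟩ := hp.exists_section
  obtain ⟨i', hi'⟩ := hp'.exists_section
  have e1 : (i ≫ p') ≫ j' = j := by
    rw [Category.assoc, ← e, reassoc_of% hi]
  have e2 : (i' ≫ p) ≫ j = j' := by
    rw [Category.assoc, e, reassoc_of% hi']
  have k1 : incl (i ≫ p') := incl_of_comp _ j' hj' (by rw [e1]; exact hj)
  have k2 : incl (i' ≫ p) := incl_of_comp _ j hj (by rw [e2]; exact hj')
  obtain rfl := incl_antisymm _ _ k1 k2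
  obtain rfl := incl_unique j j' hj hj'
  have := incl_mono j hj
  exact ⟨rfl, heq_of_eq ((cancel_mono j).1 e)⟩

/-- The image of a morphism. -/
noncomputable def im {a b : C} (f : a ⟶ b) : C := (exists_canonical f).choose

/-- The epimorphic component of a morphism. -/
noncomputable def epiPart {a b : C} (f : a ⟶ b) : a ⟶ im f :=
  (exists_canonical f).choose_spec.choose

/-- The inclusion of a morphism. -/
noncomputable def inclPart {a b : C} (f : a ⟶ b) : im f ⟶ b :=
  (exists_canonical f).choose_spec.choose_spec.choose

theorem isCanonical {a b : C} (f : a ⟶ b) : IsCanonical f (epiPart f) (inclPart f) :=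
  (exists_canonical f).choose_spec.choose_spec.choose_spec

/-- The cone `γ ∗ p`, with components `γ(c) p`. -/
def ConeAt.star {z z' : C} (γ : ConeAt C z) (p : z ⟶ z') (hp : IsNormalEpi p) :
    ConeAt C z' where
  app c := γ.app c ≫ p
  incl_app j hj := by rw [← Category.assoc, γ.incl_app j hj]
  exists_isIso := by
    obtain ⟨c, hc⟩ := γ.exists_isIso
    obtain ⟨i, hi⟩ := hp.exists_section
    obtain ⟨a', b', q, v, j, ⟨k, hk, hkq⟩, hv, hj, e⟩ :=
      NormalCategory.normal_factorisation (i ≫ inv (γ.app c))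
    have e1 : q ≫ v ≫ j ≫ γ.app c ≫ p = 𝟙 z' := by
      have := congrArg (fun t => t ≫ γ.app c ≫ p) e
      simpa [hi] using this.symm
    have hq : IsIso q := by
      have : IsSplitMono q := ⟨⟨⟨v ≫ j ≫ γ.app c ≫ p, by simpa using e1⟩⟩⟩
      have : IsSplitEpi q := ⟨⟨⟨k, hkq⟩⟩⟩
      have : Epi q := inferInstance
      exact isIso_of_epi_of_isSplitMono q
    refine ⟨b', ?_⟩
    have e2 : γ.app b' ≫ p = inv v ≫ inv q := by
      rw [← γ.incl_app j hj, IsIso.eq_inv_comp, ← cancel_epi q, IsIso.hom_inv_id]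
      simpa using e1
    rw [e2]
    infer_instance

/-- The product of cones `γ · δ = γ ∗ (δ(z_γ))°`. -/
noncomputable instance : Mul (Cones C) where
  mul γ δ := ⟨im (δ.cone.app γ.vertex),
    γ.cone.star (epiPart (δ.cone.app γ.vertex)) (isCanonical _).1⟩

theorem star_congr {x z z' : C} (γ : ConeAt C x) {p : x ⟶ z} {p' : x ⟶ z'}
    (hp : IsNormalEpi p) (hp' : IsNormalEpi p') (h : z = z' ∧ HEq p p') :
    (⟨z, γ.star p hp⟩ : Cones C) = ⟨z', γ.star p' hp'⟩ := by
  obtain ⟨rfl, h⟩ := h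
  obtain rfl := eq_of_heq h
  rfl

/-- The product may be computed from any canonical factorisation. -/
theorem mul_eq {x y z : C} (γ : ConeAt C x) (δ : ConeAt C y) {p : x ⟶ z} {j : z ⟶ y}
    (h : IsCanonical (δ.app x) p j) :
    (⟨x, γ⟩ * ⟨y, δ⟩ : Cones C) = ⟨z, γ.star p h.1⟩ :=
  star_congr γ _ _ (canonical_unique (isCanonical _) h)

theorem star_star {x y z : C} (γ : ConeAt C x) (p : x ⟶ y) (q : y ⟶ z) (hp : IsNormalEpi p)
    (hq : IsNormalEpi q) : (γ.star p hp).star q hq = γ.star (p ≫ q) (hp.comp hq) := by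
  ext c
  simp [ConeAt.star]

noncomputable instance : Semigroup (Cones C) where
  mul_assoc := by
    rintro ⟨x, γ⟩ ⟨y, δ⟩ ⟨z, η⟩
    obtain ⟨z₁, p₁, j₁, h₁⟩ := exists_canonical (δ.app x)
    obtain ⟨z₂, p₂, j₂, h₂⟩ := exists_canonical (η.app y)
    obtain ⟨z₃, p₃, j₃, h₃⟩ := exists_canonical (j₁ ≫ p₂)
    rw [mul_eq γ δ h₁, mul_eq δ η h₂]
    have k₁ : IsCanonical (η.app z₁) p₃ (j₃ ≫ j₂) := by
      refine ⟨h₃.1, incl_comp _ _ h₃.2.1 h₂.2.1, ?_⟩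
      rw [← η.incl_app j₁ h₁.2.1, h₂.2.2, ← Category.assoc, h₃.2.2, Category.assoc]
    have k₂ : IsCanonical ((δ.star p₂ h₂.1).app x) (p₁ ≫ p₃) j₃ := by
      refine ⟨h₁.1.comp h₃.1, h₃.2.1, ?_⟩
      change δ.app x ≫ p₂ = _
      rw [h₁.2.2, Category.assoc, h₃.2.2, Category.assoc]
    rw [mul_eq _ _ k₁, mul_eq _ _ k₂, star_star]

theorem isCanonical_of_isIso {a b : C} (f : a ⟶ b) [IsIso f] : IsCanonical f f (𝟙 b) :=
  ⟨IsNormalEpi.of_isIso f, incl_id b, by simp⟩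

instance : RegularSemigroup (Cones C) where
  regular := by
    rintro ⟨z, γ⟩
    obtain ⟨d, hd⟩ := γ.exists_isIso
    obtain ⟨μ, hμ⟩ := NormalCategory.exists_cone z
    have hi : IsCanonical ((μ.star (inv (γ.app d)) (IsNormalEpi.of_isIso _)).app z)
        (inv (γ.app d)) (𝟙 d) := by
      have : (μ.star (inv (γ.app d)) (IsNormalEpi.of_isIso _)).app z = inv (γ.app d) := by
        simp [ConeAt.star, hμ]
      rw [this]
      exact isCanonical_of_isIso _
    refine ⟨⟨d, μ.star (inv (γ.app d)) (IsNormalEpi.of_isIso _)⟩, ?_⟩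
    rw [mul_eq _ _ hi, mul_eq _ _ (isCanonical_of_isIso (γ.app d)), star_star]
    congr 1
    ext c
    simp [ConeAt.star]

/-- A cone is idempotent if and only if its component at its vertex is the identity. -/
theorem isIdempotentElem_iff {z : C} (μ : ConeAt C z) :
    IsIdempotentElem (⟨z, μ⟩ : Cones C) ↔ μ.app z = 𝟙 z := by
  constructor
  · intro h
    obtain ⟨w, p, j, hc⟩ := exists_canonical (μ.app z)
    rw [IsIdempotentElem, mul_eq _ _ hc] at h
    obtain ⟨c, hi⟩ := μ.exists_isIso
    injection h with h1 h2
    subst h1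
    have h3 := congrFun (congrArg ConeAt.app (eq_of_heq h2)) c
    have hp : p = 𝟙 _ := (cancel_epi (μ.app c)).1 (by simpa [ConeAt.star] using h3)
    rw [hc.2.2, hp, incl_unique j (𝟙 _) hc.2.1 (incl_id _), Category.comp_id]
  · intro h
    have hc : IsCanonical (μ.app z) (𝟙 z) (𝟙 z) := by
      rw [h]
      exact isCanonical_of_isIso (𝟙 z)
    rw [IsIdempotentElem, mul_eq _ _ hc]
    congr 1
    ext c
    simp [ConeAt.star]

/-- An idempotent cone is determined by its vertex and its R-class. -/
theorem idempotent_unique {z : C} (μ ν : ConeAt C z) (hμ : IsIdempotentElem (⟨z, μ⟩ : Cones C))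
    (hν : IsIdempotentElem (⟨z, ν⟩ : Cones C))
    (h : rClass (⟨z, μ⟩ : Cones C) = rClass ⟨z, ν⟩) : μ = ν := by
  obtain ⟨x, hx⟩ : RightLE (⟨z, ν⟩ : Cones C) ⟨z, μ⟩ := (Quotient.exact h).2
  have e : (⟨z, μ⟩ * ⟨z, ν⟩ : Cones C) = ⟨z, ν⟩ := by
    rw [hx, ← mul_assoc, hμ]
  have hc : IsCanonical (ν.app z) (𝟙 z) (𝟙 z) := by
    rw [(isIdempotentElem_iff ν).1 hν]
    exact isCanonical_of_isIso (𝟙 z)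
  rw [mul_eq _ _ hc] at e
  injection e with _ e
  rw [← e]
  ext c
  simp [ConeAt.star]

end

/-! ### Connected categories and CC-morphisms -/

/-- The object `c` is connected by the R-class `d`: some idempotent cone with vertex `c`
belongs to `d`. -/
def IsConnectedBy {C : Type u} [SmallCategory C] [NormalCategory C] (c : C)
    (d : RClass (Cones C)) : Prop :=
  ∃ ε : ConeAt C c, IsIdempotentElem (⟨c, ε⟩ : Cones C) ∧ rClass (⟨c, ε⟩ : Cones C) = d

/-- The (unique) idempotent cone `ε(c, d)` with vertex `c` in the R-class `d`. -/
noncomputable def IsConnectedBy.cone {C : Type u} [SmallCategory C] [NormalCategory C] {c : C}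
    {d : RClass (Cones C)} (h : IsConnectedBy c d) : ConeAt C c :=
  h.choose

/-- A connected category: a normal category with a down-set of the poset of R-classes of its
semigroup of cones that connects every object. -/
structure ConnectedCategory : Type (u + 1) where
  carrier : Type u
  [cat : SmallCategory carrier]
  [normal : NormalCategory carrier]
  downSet : LowerSet (RClass (Cones carrier))
  connects : ∀ c : carrier, ∃ d ∈ downSet, IsConnectedBy c d

attribute [instance] ConnectedCategory.cat ConnectedCategory.normal

/-- A CC-morphism `(F, G)`: an inclusion preserving functor `F` and an order preserving map `G`
of the connecting down-sets such that, whenever `c` is connected by `d`, `F(c)` is connected by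
`G(d)` and `F(ε(c, d)(c')) = ε(F(c), G(d))(F(c'))` for every object `c'`. -/
@[ext]
structure CCMorphism (X Y : ConnectedCategory.{u}) where
  functor : X.carrier ⥤ Y.carrier
  map : X.downSet →o Y.downSet
  map_incl : ∀ {a b : X.carrier} (j : a ⟶ b), incl j → incl (functor.map j)
  connected : ∀ (c : X.carrier) (d : X.downSet), IsConnectedBy c d.1 →
    IsConnectedBy (functor.obj c) (map d).1
  map_cone : ∀ (c : X.carrier) (d : X.downSet) (h : IsConnectedBy c d.1) (c' : X.carrier),
    functor.map (h.cone.app c') = (connected c d h).cone.app (functor.obj c')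

/-- The category of connected categories and CC-morphisms. -/
noncomputable instance : Category ConnectedCategory.{u} where
  Hom := CCMorphism
  id X :=
    { functor := 𝟭 X.carrier
      map := OrderHom.id
      map_incl := fun _ h => h
      connected := fun _ _ h => h
      map_cone := fun _ _ _ _ => rfl }
  comp {X Y Z} f g :=
    { functor := f.functor ⋙ g.functor
      map := g.map.comp f.map
      map_incl := fun j h => g.map_incl _ (f.map_incl j h)
      connected := fun c d h => g.connected _ _ (f.connected c d h)
      map_cone := fun c d h c' => by
        change g.functor.map (f.functor.map (h.cone.app c')) = _
        rw [f.map_cone c d h c']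
        exact g.map_cone _ _ (f.connected c d h) _ }
  id_comp _ := rfl
  comp_id _ := rfl
  assoc _ _ _ := rfl

/-- A bundled normal category. -/
structure NormalCat : Type (u + 1) where
  carrier : Type u
  [cat : SmallCategory carrier]
  [normal : NormalCategory carrier]

attribute [instance] NormalCat.cat NormalCat.normal

/-- A normal category, viewed as a connected category through the set of all R-classes of its
semigroup of cones. -/
noncomputable def NormalCat.toConnected (C : NormalCat.{u}) : ConnectedCategory.{u} where
  carrier := C.carrier
  downSet := ⊤
  connects c := by
    obtain ⟨μ, hμ⟩ := NormalCategory.exists_cone c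
    exact ⟨_, trivial, μ, (isIdempotentElem_iff μ).2 hμ, rfl⟩

/-- The category of normal categories with CC-morphisms. -/
noncomputable instance : Category NormalCat.{u} where
  Hom C D := C.toConnected ⟶ D.toConnected
  id C := 𝟙 C.toConnected
  comp f g := f ≫ g
  id_comp f := Category.id_comp (X := NormalCat.toConnected _) f
  comp_id f := Category.comp_id (Y := NormalCat.toConnected _) f
  assoc f g h := Category.assoc (W := NormalCat.toConnected _) f g h

/-! ### The category of principal left ideals of a regular semigroup -/

/-- The principal left ideal `Se`. -/
def leftIdeal {S : Type u} [Semigroup S] (e : S) : Set S := {x | ∃ y : S, x = y * e}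

/-- The objects of `L(S)`: the left ideals `Se` with `e` idempotent. -/
@[ext]
structure LeftCat (S : Type u) [Semigroup S] where
  ideal : Set S
  exists_idempotent : ∃ e : S, IsIdempotentElem e ∧ ideal = leftIdeal e

section

variable {S : Type u} [Semigroup S]

/-- A map from `Se` to `Sf` is of the form `r(e, v, f) : x ↦ x v` with `v ∈ eSf`. -/
def IsRightTranslation {A B : LeftCat S} (φ : A.ideal → B.ideal) : Prop :=
  ∃ e f v : S, IsIdempotentElem e ∧ IsIdempotentElem f ∧ A.ideal = leftIdeal e ∧
    B.ideal = leftIdeal f ∧ (∃ s : S, v = e * s * f) ∧ ∀ x : A.ideal, (φ x : S) = x * v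

theorem mul_of_mem_leftIdeal {e x : S} (he : IsIdempotentElem e) (hx : x ∈ leftIdeal e) :
    x * e = x := by
  obtain ⟨y, rfl⟩ := hx
  rw [mul_assoc, he]

theorem mem_leftIdeal {e : S} (he : IsIdempotentElem e) : e ∈ leftIdeal e := ⟨e, he.symm⟩

/-- The category `L(S)`. -/
instance : SmallCategory (LeftCat S) where
  Hom A B := {φ : A.ideal → B.ideal // IsRightTranslation φ}
  id A := ⟨id, by
    obtain ⟨e, he, hA⟩ := A.exists_idempotent
    refine ⟨e, e, e, he, he, hA, hA, ⟨e, by rw [he, he]⟩, fun x => ?_⟩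
    exact (mul_of_mem_leftIdeal he (hA ▸ x.2)).symm⟩
  comp {A B D} φ ψ := ⟨ψ.1 ∘ φ.1, by
    obtain ⟨e, f, v, he, hf, hA, hB, ⟨s, hs⟩, hφ⟩ := φ.2
    obtain ⟨g, h, w, hg, hh, hB', hD, ⟨t, ht⟩, hψ⟩ := ψ.2
    refine ⟨e, h, v * w, he, hh, hA, hD, ⟨s * f * (g * t), ?_⟩, fun x => ?_⟩
    · rw [hs, ht]; simp only [mul_assoc]
    · rw [Function.comp_apply, hψ, hφ, mul_assoc]⟩

theorem LeftCat.hom_ext {A B : LeftCat S} {φ ψ : A ⟶ B}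
    (h : ∀ x : A.ideal, (φ.1 x : S) = ψ.1 x) : φ = ψ :=
  Subtype.ext (funext fun x => Subtype.ext (h x))

theorem LeftCat.comp_val {A B D : LeftCat S} (φ : A ⟶ B) (ψ : B ⟶ D) (x : A.ideal) :
    (φ ≫ ψ).1 x = ψ.1 (φ.1 x) := rfl

theorem LeftCat.id_val {A : LeftCat S} (x : A.ideal) : (𝟙 A : A ⟶ A).1 x = x := rfl

/-- The inclusions of `L(S)` are the set inclusions `r(e, e, f)` of left ideals. -/
instance : CategoryWithSubobjects (LeftCat S) where
  incl A B φ := ∀ x : A.ideal, (φ.1 x : S) = x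
  incl_id _ _ := rfl
  incl_comp f g hf hg x := by rw [LeftCat.comp_val, hg, hf]
  incl_unique f g hf hg := LeftCat.hom_ext fun x => by rw [hf, hg]
  incl_antisymm {A B} f g hf hg := by
    ext x
    refine ⟨fun hx => ?_, fun hx => ?_⟩
    · have h := (f.1 ⟨x, hx⟩).2
      rwa [hf] at h
    · have h := (g.1 ⟨x, hx⟩).2
      rwa [hg] at h
  incl_mono {A B} f hf := ⟨fun {Z} g h e => LeftCat.hom_ext fun x => by
    have := congrArg (fun k : Z ⟶ B => (k.1 x : S)) e
    simpa only [LeftCat.comp_val, hf] using this⟩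
  incl_of_comp h g hg hgh x := by rw [← hg, ← LeftCat.comp_val, hgh]

/-- The object `Se`. -/
def LeftCat.of (e : S) (he : IsIdempotentElem e) : LeftCat S := ⟨leftIdeal e, e, he, rfl⟩

theorem LeftCat.of_ideal (e : S) (he : IsIdempotentElem e) :
    (LeftCat.of e he).ideal = leftIdeal e := rfl

/-- The morphism `r(e, v, f) : x ↦ x v`, for `v ∈ eSf`. -/
def LeftCat.r {A B : LeftCat S} (e v f : S) (he : IsIdempotentElem e) (hf : IsIdempotentElem f)
    (hA : A.ideal = leftIdeal e) (hB : B.ideal = leftIdeal f) (hev : e * v = v)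
    (hvf : v * f = v) : A ⟶ B :=
  ⟨fun x => ⟨x * v, hB ▸ ⟨x * v, by rw [mul_assoc, hvf]⟩⟩,
    e, f, v, he, hf, hA, hB, ⟨v, by rw [hev, hvf]⟩, fun _ => rfl⟩

theorem LeftCat.r_val {A B : LeftCat S} (e v f : S) (he : IsIdempotentElem e)
    (hf : IsIdempotentElem f) (hA : A.ideal = leftIdeal e) (hB : B.ideal = leftIdeal f)
    (hev : e * v = v) (hvf : v * f = v) (x : A.ideal) :
    ((LeftCat.r e v f he hf hA hB hev hvf).1 x : S) = x * v := rfl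

end

/-- If `S` is a regular semigroup, then `L(S)` is a normal category. -/
instance {S : Type u} [Semigroup S] [RegularSemigroup S] : NormalCategory (LeftCat S) where
  incl_splits {A B} j hj := by
    obtain ⟨e, he, hA⟩ := A.exists_idempotent
    obtain ⟨f, hf, hB⟩ := B.exists_idempotent
    have hef : e * f = e := by
      have h1 : e ∈ A.ideal := hA ▸ mem_leftIdeal he
      have h2 := (j.1 ⟨e, h1⟩).2
      rw [hj, hB] at h2
      exact mul_of_mem_leftIdeal hf h2
    refine ⟨LeftCat.r f (f * e) e hf he hB hA (by rw [← mul_assoc, hf])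
      (by rw [mul_assoc, he]), LeftCat.hom_ext fun x => ?_⟩
    have hx : (x : S) * e = x := mul_of_mem_leftIdeal he (hA ▸ x.2)
    have hxf : (x : S) * f = x := by rw [← hx, mul_assoc, hef]
    rw [LeftCat.comp_val, LeftCat.r_val, hj, LeftCat.id_val, ← mul_assoc, hxf, hx]
  normal_factorisation {A B} φ := by
    obtain ⟨e, f, v, he, hf, hA, hB, ⟨s, hs⟩, hφ⟩ := φ.2
    have hev : e * v = v := by rw [hs, ← mul_assoc, ← mul_assoc, he]
    have hvf : v * f = v := by rw [hs, mul_assoc, hf]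
    obtain ⟨x, hx⟩ := RegularSemigroup.regular v
    have hxv : IsIdempotentElem (x * v) := by
      rw [IsIdempotentElem, mul_assoc, ← mul_assoc v, hx]
    have hg : IsIdempotentElem (v * x * e) := by
      rw [IsIdempotentElem, mul_assoc (v * x) e, mul_assoc v x e, ← mul_assoc e, hev, ← mul_assoc v,
        ← mul_assoc (v * x), ← mul_assoc (v * x), hx]
    have hgv : v * x * e * v = v := by rw [mul_assoc (v * x), hev, hx]
    have heg : e * (v * x * e) = v * x * e := by rw [← mul_assoc, ← mul_assoc, hev]
    have hge : v * x * e * e = v * x * e := by rw [mul_assoc (v * x), he]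
    have hvh : v * (x * v) = v := by rw [← mul_assoc, hx]
    have hhf : x * v * f = x * v := by rw [mul_assoc, hvf]
    refine ⟨LeftCat.of _ hg, LeftCat.of _ hxv,
      LeftCat.r e (v * x * e) (v * x * e) he hg hA (LeftCat.of_ideal _ hg) heg hg.eq,
      LeftCat.r (v * x * e) v (x * v) hg hxv (LeftCat.of_ideal _ hg) (LeftCat.of_ideal _ hxv)
        hgv hvh,
      LeftCat.r (x * v) (x * v) f hxv hf (LeftCat.of_ideal _ hxv) hB hxv.eq hhf, ?_, ?_, ?_, ?_⟩
    · refine ⟨LeftCat.r (v * x * e) (v * x * e) e hg he (LeftCat.of_ideal _ hg) hA hg.eq hge, fun y => ?_,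
        LeftCat.hom_ext fun y => ?_⟩
      · exact mul_of_mem_leftIdeal hg y.2
      · have hy := mul_of_mem_leftIdeal hg y.2
        rw [LeftCat.comp_val, LeftCat.r_val, LeftCat.r_val, LeftCat.id_val, hy, hy]
    · refine ⟨LeftCat.r (x * v) (x * v * (x * e)) (v * x * e) hxv hg (LeftCat.of_ideal _ hxv)
        (LeftCat.of_ideal _ hg)
        (by rw [← mul_assoc, hxv]) ?_, LeftCat.hom_ext fun y => ?_, LeftCat.hom_ext fun y => ?_⟩
      · have : x * v * (x * e) = x * (v * x * e) := by simp only [mul_assoc]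
        rw [this, mul_assoc, hg]
      · have hy := mul_of_mem_leftIdeal hg y.2
        rw [LeftCat.comp_val, LeftCat.r_val, LeftCat.r_val, LeftCat.id_val]
        have : (y : S) * v * (x * v * (x * e)) = y * (v * x * v * x * e) := by
          simp only [mul_assoc]
        rw [this, hx, hy]
      · have hy := mul_of_mem_leftIdeal hxv y.2
        rw [LeftCat.comp_val, LeftCat.r_val, LeftCat.r_val, LeftCat.id_val]
        have : (y : S) * (x * v * (x * e)) * v = y * (x * v) * x * (e * v) := by
          simp only [mul_assoc]
        rw [this, hy, hev, mul_assoc, hy]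
    · exact fun y => mul_of_mem_leftIdeal hxv y.2
    · refine LeftCat.hom_ext fun y => ?_
      rw [LeftCat.comp_val, LeftCat.comp_val, LeftCat.r_val, LeftCat.r_val, LeftCat.r_val, hφ,
        mul_assoc, mul_assoc, ← mul_assoc (v * x * e), hgv, hvh]
  exists_cone A := by
    obtain ⟨e, he, hA⟩ := A.exists_idempotent
    have key : ∀ B : LeftCat S, IsRightTranslation (A := B) (B := A)
        (fun x => ⟨x * e, hA ▸ ⟨x, rfl⟩⟩) := fun B => by
      obtain ⟨g, hg, hB⟩ := B.exists_idempotent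
      exact ⟨g, e, g * e, hg, he, hB, hA, ⟨e, by rw [mul_assoc, he]⟩, fun x => by
        rw [← mul_assoc, mul_of_mem_leftIdeal hg (hB ▸ x.2)]⟩
    have h1 : (⟨_, key A⟩ : A ⟶ A) = 𝟙 A := LeftCat.hom_ext fun x =>
      mul_of_mem_leftIdeal he (hA ▸ x.2)
    refine ⟨⟨fun B => ⟨_, key B⟩, fun {B D} j hj => LeftCat.hom_ext fun x => ?_, A, ?_⟩, h1⟩
    · rw [LeftCat.comp_val]
      change ((j.1 x : D.ideal) : S) * e = x * e
      rw [hj]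
    · rw [h1]
      infer_instance

/-! ### Totally left reductive semigroups -/

/-- A semigroup `S` is totally left reductive if it is regular and isomorphic to the semigroup
of all cones in `L(S)`. -/
def IsTotallyLeftReductive : ObjectProperty Semigrp.{u} := fun S =>
  ∃ _ : RegularSemigroup S, Nonempty (S ≃* Cones (LeftCat S))

/-- The category of totally left reductive semigroups and semigroup homomorphisms. -/
abbrev TotallyLeftReductiveSemigrp : Type (u + 1) :=
  ObjectProperty.FullSubcategory IsTotallyLeftReductive.{u}

end ConnCat

/-! The equivalence sends a normal category to its semigroup of cones. Everything rests on reading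
the category off that semigroup. A cone `x` lies in the left ideal generated by `y` exactly when the
vertex of `x` is a subobject of that of `y` (`Cones.mem_leftIdeal_iff`), so principal left ideals
are objects. A morphism `f` out of `c` is recorded by the cone that it produces from an idempotent
cone with vertex `c`, and nothing is lost (`Cones.act_injective`).

Hence right multiplications identify `Cones C` with the cones of its own principal left ideals
(`mulConeHom_injective`, `mulConeHom_surjective`), and semigroups of cones are totally left
reductive. Essential surjectivity is then immediate: a totally left reductive `S` is by definition
isomorphic to the cones of `LeftCat S`.

A pair `(F, G)` sends a cone `γ` with vertex `z` to the unique cone with vertex `F z`, in the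
R-class prescribed by `G`, whose components at the objects `F c` are `F (γ c)`. Uniqueness holds
because a cone below `η` in the R-order is determined by one component at which `η` is invertible
(`ConeAt.eq_of_le`); the same principle gives multiplicativity. Conversely, a homomorphism preserves
the order of left ideals and of R-classes, so it acts on objects, inclusions and R-classes, and on
morphisms through their recording cones. The two constructions match (`IsCC.eq_of_coneHom_eq`,
`coneHom_isCC_of_hom`), giving a fully faithful functor. -/

namespace ConnCat

open CategoryWithSubobjects

/-! ### Cones acted on by morphisms -/

section

variable {C : Type u} [SmallCategory C] [NormalCategory C]

/-- There is an inclusion of `a` in `b`. -/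
def IsSubobject (a b : C) : Prop := ∃ j : a ⟶ b, incl j

theorem IsSubobject.antisymm {a b : C} (h : IsSubobject a b) (k : IsSubobject b a) : a = b := by
  obtain ⟨f, hf⟩ := h
  obtain ⟨g, hg⟩ := k
  exact incl_antisymm f g hf hg

theorem IsSubobject.trans {a b c : C} (h : IsSubobject a b) (k : IsSubobject b c) :
    IsSubobject a c := by
  obtain ⟨f, hf⟩ := h
  obtain ⟨g, hg⟩ := k
  exact ⟨f ≫ g, incl_comp f g hf hg⟩

/-- The cone `x ∗ f°`. -/
noncomputable def Cones.act (x : Cones C) {c : C} (f : x.vertex ⟶ c) : Cones C :=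
  ⟨im f, x.cone.star (epiPart f) (isCanonical f).1⟩

theorem Cones.mul_eq_act (x y : Cones C) : x * y = x.act (y.cone.app x.vertex) := rfl

theorem Cones.act_eq (x : Cones C) {c z : C} {f : x.vertex ⟶ c} {p : x.vertex ⟶ z} {j : z ⟶ c}
    (h : IsCanonical f p j) : x.act f = ⟨z, x.cone.star p h.1⟩ :=
  star_congr x.cone _ _ (canonical_unique (isCanonical f) h)

theorem Cones.act_vertex (x : Cones C) {c : C} (f : x.vertex ⟶ c) :
    IsSubobject (x.act f).vertex c := ⟨inclPart f, (isCanonical f).2.1⟩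

theorem Cones.mul_vertex (x y : Cones C) : IsSubobject (x * y).vertex y.vertex :=
  x.act_vertex _

theorem Cones.act_incl (x : Cones C) {c : C} (j : x.vertex ⟶ c) (hj : incl j) : x.act j = x := by
  have h : IsCanonical j (𝟙 _) j := ⟨IsNormalEpi.of_isIso _, hj, by simp⟩
  rw [x.act_eq h]
  obtain ⟨z, γ⟩ := x
  congr 1
  ext c
  simp [ConeAt.star]

/-- Normal epimorphisms compose, so the epimorphic part of `f ≫ g` is that of `f` followed by that
of `g` restricted to the image of `f`. The inclusion `j` is left arbitrary so that callers need not
know the chosen one. -/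
theorem Cones.act_act (x : Cones C) {c d : C} (f : x.vertex ⟶ c) (j : (x.act f).vertex ⟶ c)
    (hj : incl j) (g : c ⟶ d) : (x.act f).act (j ≫ g) = x.act (f ≫ g) := by
  have e : j = inclPart f := incl_unique _ _ hj (isCanonical f).2.1
  subst e
  obtain ⟨w, p, k, h⟩ := exists_canonical (inclPart f ≫ g)
  have h' : IsCanonical (f ≫ g) (epiPart f ≫ p) k := by
    refine ⟨(isCanonical f).1.comp h.1, h.2.1, ?_⟩
    rw [Category.assoc, ← h.2.2, ← Category.assoc, ← (isCanonical f).2.2]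
  rw [x.act_eq h']
  exact (Cones.act_eq (x.act f) h).trans (congrArg (Cones.mk w) (star_star _ _ _ (isCanonical f).1 h.1))

theorem Cones.act_comp_incl (x : Cones C) {c d : C} (f : x.vertex ⟶ c) (j : c ⟶ d)
    (hj : incl j) : x.act (f ≫ j) = x.act f := by
  obtain ⟨k, hk⟩ := x.act_vertex f
  rw [← x.act_act f k hk, Cones.act_incl _ _ (incl_comp _ _ hk hj)]

/-- Some component of a cone is invertible and can be cancelled. This turns equalities in the
semigroup into equalities of morphisms, and most later identities in the category are proved through
it. -/
theorem Cones.act_injective (x : Cones C) {c : C} {f g : x.vertex ⟶ c}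
    (h : x.act f = x.act g) : f = g := by
  obtain ⟨w, p, j, hf⟩ := exists_canonical f
  obtain ⟨w', p', j', hg⟩ := exists_canonical g
  rw [x.act_eq hf, x.act_eq hg] at h
  injection h with h1 h2
  subst h1
  obtain ⟨d, hd⟩ := x.cone.exists_isIso
  have h3 := congrFun (congrArg ConeAt.app (eq_of_heq h2)) d
  have hp : p = p' := (cancel_epi (x.cone.app d)).1 h3
  rw [hf.2.2, hg.2.2, hp, incl_unique j j' hf.2.1 hg.2.1]

theorem Cones.mul_act (x y : Cones C) {c : C} (f : y.vertex ⟶ c) :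
    x * y.act f = x.act (y.cone.app x.vertex ≫ f) := by
  have e : y.cone.app x.vertex ≫ f = (y.cone.app x.vertex ≫ epiPart f) ≫ inclPart f := by
    rw [Category.assoc, ← (isCanonical f).2.2]
  rw [e, Cones.act_comp_incl _ _ _ (isCanonical f).2.1]
  rfl

/-- Multiplication on the right by `y`, read at any object containing the vertex of `x`. -/
theorem Cones.act_app (x y : Cones C) {c : C} (k : x.vertex ⟶ c) (hk : incl k) :
    x.act (k ≫ y.cone.app c) = x * y := by
  rw [y.cone.incl_app k hk, Cones.mul_eq_act]

/-- A chosen idempotent cone with vertex `c`. -/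
noncomputable def unitConeAt (c : C) : ConeAt C c := (NormalCategory.exists_cone c).choose

theorem unitConeAt_app (c : C) : (unitConeAt c).app c = 𝟙 c :=
  (NormalCategory.exists_cone c).choose_spec

/-- The chosen idempotent cone with vertex `c`, as an element of the semigroup of cones. -/
noncomputable abbrev unitCone (c : C) : Cones C := ⟨c, unitConeAt c⟩

theorem Cones.mul_of_isSubobject {x e : Cones C} (he : e.cone.app e.vertex = 𝟙 e.vertex)
    (h : IsSubobject x.vertex e.vertex) : x * e = x := by
  obtain ⟨k, hk⟩ := h
  rw [← x.act_app e k hk, he, Category.comp_id, x.act_incl k hk]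

theorem Cones.mul_unitCone {x : Cones C} {c : C} (h : IsSubobject x.vertex c) :
    x * unitCone c = x :=
  Cones.mul_of_isSubobject (e := unitCone c) (unitConeAt_app c) h

theorem Cones.mem_leftIdeal_iff {x y : Cones C} :
    x ∈ leftIdeal y ↔ IsSubobject x.vertex y.vertex := by
  constructor
  · rintro ⟨s, rfl⟩
    exact Cones.mul_vertex s y
  · intro h
    obtain ⟨d, hd⟩ := y.cone.exists_isIso
    -- Inverting a component of `y` gives a left multiplier that carries `y` to the idempotent cone
    -- at its vertex, which is a right identity for `x`.
    let u : (unitCone y.vertex).vertex ⟶ d :=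
      letI : IsIso (y.cone.app d) := hd
      inv (y.cone.app d)
    obtain ⟨k, hk⟩ := (unitCone y.vertex).act_vertex u
    have e : (unitCone y.vertex).act u * y = unitCone y.vertex := by
      rw [← Cones.act_app _ y k hk, Cones.act_act _ _ _ hk]
      have : u ≫ y.cone.app d = 𝟙 _ := @IsIso.inv_hom_id _ _ _ _ _ hd
      rw [this]
      exact Cones.act_incl _ _ (incl_id _)
    refine ⟨x * (unitCone y.vertex).act u, ?_⟩
    rw [mul_assoc, e, Cones.mul_unitCone h]

theorem Cones.exists_eq_mk (x : Cones C) {c : C} (h : x.vertex = c) :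
    ∃ γ : ConeAt C c, x = ⟨c, γ⟩ := by
  subst h
  exact ⟨x.cone, rfl⟩

theorem Cones.eq_mk_of_eq {c : C} {γ δ : ConeAt C c} (h : (⟨c, γ⟩ : Cones C) = ⟨c, δ⟩) :
    γ = δ := by
  injection h with _ h

theorem rightLE_star {z w : C} (γ : ConeAt C z) (p : z ⟶ w) (hp : IsNormalEpi p) :
    RightLE (⟨w, γ.star p hp⟩ : Cones C) ⟨z, γ⟩ := by
  have h : IsCanonical p p (𝟙 w) := ⟨hp, incl_id _, by simp⟩
  refine ⟨(unitCone z).act p, ?_⟩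
  have e : (⟨z, γ⟩ : Cones C) * (unitCone z).act p = Cones.act ⟨z, γ⟩ p := by
    refine (Cones.mul_act _ _ _).trans (congrArg (Cones.act ⟨z, γ⟩) ?_)
    rw [unitConeAt_app, Category.id_comp]
  rw [e]
  exact (Cones.act_eq ⟨z, γ⟩ h).symm

/-- Multiplying on the right only composes with the epimorphic part of a single component. With
`rightLE_star`, this describes the R-order concretely. -/
theorem RightLE.exists_star {z w : C} {γ : ConeAt C z} {δ : ConeAt C w}
    (h : RightLE (⟨w, δ⟩ : Cones C) ⟨z, γ⟩) : ∃ (p : z ⟶ w) (hp : IsNormalEpi p),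
      δ = γ.star p hp := by
  obtain ⟨⟨v, η⟩, h⟩ := h
  obtain ⟨v', p, j, hc⟩ := exists_canonical (η.app z)
  rw [mul_eq _ _ hc] at h
  injection h with h1 h2
  subst h1
  exact ⟨p, hc.1, eq_of_heq h2⟩

theorem rClass_le_iff {x y : Cones C} : rClass x ≤ rClass y ↔ RightLE x y := Iff.rfl

theorem rClass_star_isIso {z w : C} (γ : ConeAt C z) (p : z ⟶ w) [IsIso p] :
    rClass (⟨w, γ.star p (IsNormalEpi.of_isIso p)⟩ : Cones C) = rClass ⟨z, γ⟩ := by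
  refine Quotient.sound ⟨rightLE_star _ _ _, ?_⟩
  have := rightLE_star (γ.star p (IsNormalEpi.of_isIso p)) (inv p) (IsNormalEpi.of_isIso _)
  have e : (γ.star p (IsNormalEpi.of_isIso p)).star (inv p) (IsNormalEpi.of_isIso _) = γ := by
    ext c
    simp [ConeAt.star]
  rwa [e] at this

/-- A cone below `η` is determined by its component at an object where `η` is invertible. -/
theorem ConeAt.eq_of_le {z w : C} {δ δ' : ConeAt C w} {η : ConeAt C z}
    (h : rClass (⟨w, δ⟩ : Cones C) ≤ rClass ⟨z, η⟩)
    (h' : rClass (⟨w, δ'⟩ : Cones C) ≤ rClass ⟨z, η⟩) (b : C) [IsIso (η.app b)]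
    (e : δ.app b = δ'.app b) : δ = δ' := by
  obtain ⟨p, hp, rfl⟩ := RightLE.exists_star (rClass_le_iff.1 h)
  obtain ⟨p', hp', rfl⟩ := RightLE.exists_star (rClass_le_iff.1 h')
  obtain rfl : p = p' := (cancel_epi (η.app b)).1 e
  rfl

end

/-! ### The representation of a regular semigroup by cones of principal left ideals -/

section

variable {S : Type u} [Semigroup S]

theorem LeftCat.exists_mul {A B : LeftCat S} (φ : A ⟶ B) :
    ∃ v : S, ∀ x : A.ideal, (φ.1 x : S) = x * v := by
  obtain ⟨e, f, v, -, -, -, -, -, h⟩ := φ.2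
  exact ⟨v, h⟩

/-- Right multiplication by `s`, as a morphism of principal left ideals. -/
def LeftCat.mulRight (A B : LeftCat S) (s : S) (h : ∀ x ∈ A.ideal, x * s ∈ B.ideal) : A ⟶ B :=
  ⟨fun x => ⟨x * s, h x x.2⟩, by
    obtain ⟨e, he, hA⟩ := A.exists_idempotent
    obtain ⟨f, hf, hB⟩ := B.exists_idempotent
    refine ⟨e, f, e * s * f, he, hf, hA, hB, ⟨s, rfl⟩, fun x => ?_⟩
    have h1 : (x : S) * e = x := mul_of_mem_leftIdeal he (hA ▸ x.2)
    have h2 : (x : S) * s * f = x * s := mul_of_mem_leftIdeal hf (hB ▸ h x x.2)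
    change (x : S) * s = _
    rw [← mul_assoc, ← mul_assoc, h1, h2]⟩

theorem LeftCat.cones_ext [RegularSemigroup S] {Γ Δ : Cones (LeftCat S)} (h : Γ.vertex = Δ.vertex)
    (h' : ∀ (A : LeftCat S) (x : A.ideal),
      ((Γ.cone.app A).1 x : S) = ((Δ.cone.app A).1 x : S)) : Γ = Δ := by
  obtain ⟨z, Γ⟩ := Γ
  obtain ⟨w, Δ⟩ := Δ
  obtain rfl : z = w := h
  congr 1
  ext A
  exact LeftCat.hom_ext (h' A)

theorem LeftCat.exists_mem (x : S) [RegularSemigroup S] : ∃ A : LeftCat S, x ∈ A.ideal := by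
  obtain ⟨y, hy⟩ := RegularSemigroup.regular x
  have h : IsIdempotentElem (y * x) := by
    rw [IsIdempotentElem, mul_assoc, ← mul_assoc x, hy]
  exact ⟨LeftCat.of _ h, x, by rw [← mul_assoc, hy]⟩

variable [RegularSemigroup S]

theorem self_mem_leftIdeal (a : S) : a ∈ leftIdeal a := by
  obtain ⟨x, hx⟩ := RegularSemigroup.regular a
  exact ⟨a * x, hx.symm⟩

/-- The principal left ideal generated by an arbitrary element. -/
def LeftCat.span (a : S) : LeftCat S :=
  ⟨leftIdeal a, by
    obtain ⟨x, hx⟩ := RegularSemigroup.regular a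
    refine ⟨x * a, by rw [IsIdempotentElem, mul_assoc, ← mul_assoc a, hx], Set.ext fun y => ?_⟩
    constructor
    · rintro ⟨s, rfl⟩
      exact ⟨s * a, by rw [mul_assoc, ← mul_assoc a, hx]⟩
    · rintro ⟨s, rfl⟩
      exact ⟨s * x, (mul_assoc _ _ _).symm⟩⟩

/-- The cone of right multiplications by `a`. -/
def mulCone (a : S) : ConeAt (LeftCat S) (LeftCat.span a) where
  app A := LeftCat.mulRight A _ a fun x _ => ⟨x, rfl⟩
  incl_app {A B} j hj := LeftCat.hom_ext fun x => congrArg (· * a) (hj x)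
  exists_isIso := by
    obtain ⟨x, hx⟩ := RegularSemigroup.regular a
    -- Since `a * x * a = a`, right multiplications by `a` and by `x` are mutually inverse between
    -- `S(ax)` and `Sa`.
    refine ⟨LeftCat.span (a * x), LeftCat.mulRight _ _ x ?_, LeftCat.hom_ext fun y => ?_,
      LeftCat.hom_ext fun y => ?_⟩
    · rintro y ⟨s, rfl⟩
      exact ⟨s, mul_assoc _ _ _⟩
    · obtain ⟨_, s, rfl⟩ := y
      change s * (a * x) * a * x = s * (a * x)
      rw [mul_assoc s, hx, mul_assoc]
    · obtain ⟨_, s, rfl⟩ := y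
      change s * a * x * a = s * a
      rw [mul_assoc s, mul_assoc s, hx]

/-- The regular representation `S → Cones (L(S))`. -/
noncomputable def mulConeHom (S : Type u) [Semigroup S] [RegularSemigroup S] :
    S →ₙ* Cones (LeftCat S) where
  toFun a := ⟨LeftCat.span a, mulCone a⟩
  map_mul' a b := by
    have h1 : ∀ x ∈ (LeftCat.span a).ideal, x * b ∈ (LeftCat.span (a * b)).ideal := by
      rintro x ⟨s, rfl⟩
      exact ⟨s, mul_assoc _ _ _⟩
    have h2 : ∀ x ∈ (LeftCat.span (a * b)).ideal, x ∈ (LeftCat.span b).ideal := by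
      rintro x ⟨s, rfl⟩
      exact ⟨s * a, (mul_assoc _ _ _).symm⟩
    -- Right multiplication by `y * (a * b)` fixes `S(ab)` pointwise, which presents the inclusion
    -- into `Sb` as a right multiplication.
    obtain ⟨y, hy⟩ := RegularSemigroup.regular (a * b)
    have h3 : ∀ x ∈ (LeftCat.span (a * b)).ideal, x * (y * (a * b)) = x := by
      rintro x ⟨s, rfl⟩
      rw [mul_assoc, ← mul_assoc _ y, hy]
    let p := LeftCat.mulRight _ _ b h1
    let j : LeftCat.span (a * b) ⟶ LeftCat.span b :=
      LeftCat.mulRight _ _ (y * (a * b)) fun x hx => by rw [h3 x hx]; exact h2 x hx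
    -- `p` is onto, hence epi, and epimorphisms of a normal category are normal; no retraction has
    -- to be exhibited.
    have hp : Epi p := ⟨fun {Z} g h e => LeftCat.hom_ext fun x => by
      obtain ⟨_, s, rfl⟩ := x
      have := congrArg (fun k : LeftCat.span a ⟶ Z => (k.1 ⟨s * a, s, rfl⟩ : S)) e
      have e2 : p.1 ⟨s * a, s, rfl⟩ = ⟨s * (a * b), s, rfl⟩ := Subtype.ext (mul_assoc _ _ _)
      simpa only [LeftCat.comp_val, e2] using this⟩
    have hc : IsCanonical ((mulCone b).app (LeftCat.span a)) p j := by
      refine ⟨IsNormalEpi.of_epi p, fun x => h3 x x.2, LeftCat.hom_ext fun x => ?_⟩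
      exact (h3 _ (h1 x x.2)).symm
    rw [mul_eq _ _ hc]
    refine LeftCat.cones_ext rfl fun A x => ?_
    exact (mul_assoc (x : S) a b).symm

theorem mulConeHom_app (a : S) (A : LeftCat S) (x : A.ideal) :
    (((mulConeHom S a).cone.app A).1 x : S) = x * a := rfl

theorem mul_eq_of_mulConeHom_eq {a b : S} (h : mulConeHom S a = mulConeHom S b) (x : S) :
    x * a = x * b := by
  obtain ⟨A, hx⟩ := LeftCat.exists_mem x
  exact congrArg (fun Γ : Cones (LeftCat S) => ((Γ.cone.app A).1 ⟨x, hx⟩ : S)) h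

end

/-! ### Semigroups of cones are totally left reductive -/

section

variable {C : Type u} [SmallCategory C] [NormalCategory C]

/-- The principal left ideal of cones whose vertex is a subobject of `c`. -/
noncomputable def coneIdeal (c : C) : LeftCat (Cones C) := LeftCat.span (unitCone c)

theorem mem_coneIdeal {c : C} {x : Cones C} :
    x ∈ (coneIdeal c).ideal ↔ IsSubobject x.vertex c :=
  Cones.mem_leftIdeal_iff (y := unitCone c)

theorem span_eq_coneIdeal (x : Cones C) : LeftCat.span x = coneIdeal x.vertex := by
  ext y
  exact Cones.mem_leftIdeal_iff.trans mem_coneIdeal.symm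

theorem exists_eq_coneIdeal (A : LeftCat (Cones C)) : ∃ c, A = coneIdeal c := by
  obtain ⟨e, he, hA⟩ := A.exists_idempotent
  refine ⟨e.vertex, ?_⟩
  rw [← span_eq_coneIdeal]
  exact LeftCat.ext hA

theorem unitCone_mem_coneIdeal (c : C) : unitCone c ∈ (coneIdeal c).ideal :=
  mem_coneIdeal.2 ⟨𝟙 c, incl_id c⟩

/-- The map is a right multiplication and the unit cone at `c` is a right identity on its domain, so
the image `y` of that unit cone determines it; `g` is the component of `y` at `c`, included in `d`.
-/
theorem exists_act_of_hom {c d : C} (φ : coneIdeal c ⟶ coneIdeal d) :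
    ∃ g : c ⟶ d, ∀ (x : (coneIdeal c).ideal) (k : x.1.vertex ⟶ c), incl k →
      (φ.1 x : Cones C) = x.1.act (k ≫ g) := by
  obtain ⟨v, hv⟩ := LeftCat.exists_mul φ
  obtain ⟨y, hy⟩ : ∃ y : Cones C, y = φ.1 ⟨_, unitCone_mem_coneIdeal c⟩ := ⟨_, rfl⟩
  obtain ⟨j, hj⟩ : IsSubobject y.vertex d := mem_coneIdeal.1 (hy ▸ (φ.1 _).2)
  refine ⟨y.cone.app c ≫ j, fun x k hk => ?_⟩
  rw [← Category.assoc, Cones.act_comp_incl _ _ _ hj, Cones.act_app _ _ _ hk, hy, hv, hv,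
    ← mul_assoc, Cones.mul_unitCone ⟨k, hk⟩]

/-- By regularity `a = s * a`, which equals `s * b`, and symmetrically; so the vertices are
subobjects of each other. Multiplying unit cones then recovers each component. -/
theorem mulConeHom_injective : Function.Injective (mulConeHom (Cones C)) := by
  intro a b h
  have h1 := mul_eq_of_mulConeHom_eq h
  have h2 : a.vertex = b.vertex := by
    have e : ∀ x y : Cones C, x ∈ leftIdeal y → IsSubobject x.vertex y.vertex :=
      fun x y => Cones.mem_leftIdeal_iff.1
    refine IsSubobject.antisymm (e _ _ ?_) (e _ _ ?_)
    · obtain ⟨s, hs⟩ := self_mem_leftIdeal a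
      exact ⟨s, hs.trans (h1 s)⟩
    · obtain ⟨s, hs⟩ := self_mem_leftIdeal b
      exact ⟨s, hs.trans (h1 s).symm⟩
  obtain ⟨z, α⟩ := a
  obtain ⟨γ, rfl⟩ := Cones.exists_eq_mk b h2.symm
  congr 1
  ext c
  exact Cones.act_injective (unitCone c) (h1 (unitCone c))

/-- The components of `Γ`, and the inverse of an invertible one, all come from morphisms of `C`; the
cone axioms are checked by acting on unit cones. -/
theorem mulConeHom_surjective : Function.Surjective (mulConeHom (Cones C)) := by
  rintro ⟨A, Γ⟩
  obtain ⟨z, rfl⟩ := exists_eq_coneIdeal A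
  choose g hg using fun c : C => exists_act_of_hom (Γ.app (coneIdeal c))
  let γ : ConeAt C z :=
    { app := g
      incl_app := fun {a b} j hj => by
        refine Cones.act_injective (unitCone a) ?_
        have hm : unitCone a ∈ (coneIdeal b).ideal := mem_coneIdeal.2 ⟨j, hj⟩
        have hle : ∀ x ∈ (coneIdeal a).ideal, x ∈ (coneIdeal b).ideal := fun x hx =>
          mem_coneIdeal.2 ((mem_coneIdeal.1 hx).trans ⟨j, hj⟩)
        have hu : ∀ x ∈ (coneIdeal a).ideal, x * unitCone a = x := fun x hx =>
          Cones.mul_unitCone (mem_coneIdeal.1 hx)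
        let i : coneIdeal a ⟶ coneIdeal b :=
          LeftCat.mulRight _ _ (unitCone a) fun x hx => by rw [hu x hx]; exact hle x hx
        have hi : incl i := fun x => hu x x.2
        have h1 := hg b ⟨_, hm⟩ j hj
        have h2 := hg a ⟨_, unitCone_mem_coneIdeal a⟩ (𝟙 a) (incl_id a)
        rw [← Γ.incl_app i hi, LeftCat.comp_val] at h2
        have h3 : i.1 ⟨_, unitCone_mem_coneIdeal a⟩ = ⟨_, hm⟩ := Subtype.ext (hi _)
        rw [h3, h1, Category.id_comp] at h2
        exact h2
      exists_isIso := by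
        obtain ⟨B, hB⟩ := Γ.exists_isIso
        obtain ⟨c, rfl⟩ := exists_eq_coneIdeal B
        obtain ⟨h, hh⟩ := exists_act_of_hom (inv (Γ.app (coneIdeal c)))
        refine ⟨c, h, ?_, ?_⟩
        · refine Cones.act_injective (unitCone c) ?_
          have h1 := hg c ⟨_, unitCone_mem_coneIdeal c⟩ (𝟙 c) (incl_id c)
          rw [Category.id_comp] at h1
          obtain ⟨k, hk⟩ := (unitCone c).act_vertex (g c)
          have h2 := hh ((Γ.app (coneIdeal c)).1 ⟨_, unitCone_mem_coneIdeal c⟩)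
          rw [← LeftCat.comp_val, IsIso.hom_inv_id, LeftCat.id_val, h1] at h2
          have h3 := h2 k hk
          rw [Cones.act_act _ _ _ hk] at h3
          rw [← h3]
          exact (Cones.act_incl (unitCone c) (𝟙 c) (incl_id c)).symm
        · refine Cones.act_injective (unitCone z) ?_
          have h1 := hh ⟨_, unitCone_mem_coneIdeal z⟩ (𝟙 z) (incl_id z)
          rw [Category.id_comp] at h1
          obtain ⟨k, hk⟩ := (unitCone z).act_vertex h
          have h2 := hg c ((inv (Γ.app (coneIdeal c))).1 ⟨_, unitCone_mem_coneIdeal z⟩)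
          rw [← LeftCat.comp_val, IsIso.inv_hom_id, LeftCat.id_val, h1] at h2
          have h3 := h2 k hk
          rw [Cones.act_act _ _ _ hk] at h3
          rw [← h3]
          exact (Cones.act_incl (unitCone z) (𝟙 z) (incl_id z)).symm }
  refine ⟨⟨z, γ⟩, LeftCat.cones_ext (span_eq_coneIdeal _) fun B x => ?_⟩
  obtain ⟨c, rfl⟩ := exists_eq_coneIdeal B
  obtain ⟨k, hk⟩ := mem_coneIdeal.1 x.2
  rw [mulConeHom_app, hg c x k hk]
  exact (Cones.act_app x.1 ⟨z, γ⟩ k hk).symm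

variable (C) in
theorem isTotallyLeftReductive_cones : IsTotallyLeftReductive (Semigrp.of (Cones C)) :=
  ⟨inferInstanceAs (RegularSemigroup (Cones C)),
    ⟨MulEquiv.ofBijective (mulConeHom (Cones C)) ⟨mulConeHom_injective, mulConeHom_surjective⟩⟩⟩

end

/-! ### CC-morphisms induce homomorphisms of the semigroups of cones -/

section

variable {C D E : Type u} [SmallCategory C] [NormalCategory C] [SmallCategory D]
  [NormalCategory D] [SmallCategory E] [NormalCategory E]

/-- The pair `(F, G)` is a CC-morphism, expressed through idempotent cones. -/
structure IsCC (F : C ⥤ D) (G : RClass (Cones C) → RClass (Cones D)) : Prop where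
  mono : Monotone G
  map_incl : ∀ {a b : C} (j : a ⟶ b), incl j → incl (F.map j)
  map_cone : ∀ (z : C) (ε : ConeAt C z), ε.app z = 𝟙 z → ∃ η : ConeAt D (F.obj z),
    η.app (F.obj z) = 𝟙 _ ∧ rClass (⟨_, η⟩ : Cones D) = G (rClass ⟨z, ε⟩) ∧
      ∀ c, η.app (F.obj c) = F.map (ε.app c)

variable {F : C ⥤ D} {G : RClass (Cones C) → RClass (Cones D)}

theorem IsCC.map_isNormalEpi (h : IsCC F G) {a b : C} {p : a ⟶ b} (hp : IsNormalEpi p) :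
    IsNormalEpi (F.map p) := by
  obtain ⟨a', q, v, ⟨j, hj, hjq⟩, hv, rfl⟩ := hp
  exact ⟨F.obj a', F.map q, F.map v, ⟨F.map j, h.map_incl j hj, by rw [← F.map_comp, hjq, F.map_id]⟩,
    inferInstance, F.map_comp _ _⟩

/-- If `γ.app d` is invertible, `γ` is an idempotent cone at `d` followed by that isomorphism.
Composing with an isomorphism preserves the R-class, so the hypothesis on idempotent cones extends
to all cones. -/
theorem IsCC.exists_coneMap (h : IsCC F G) {z : C} (γ : ConeAt C z) :
    ∃ δ : ConeAt D (F.obj z), rClass (⟨_, δ⟩ : Cones D) = G (rClass ⟨z, γ⟩) ∧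
      ∀ c, δ.app (F.obj c) = F.map (γ.app c) := by
  obtain ⟨d, hd⟩ := γ.exists_isIso
  obtain ⟨η, -, hη, hηF⟩ := h.map_cone d (γ.star (inv (γ.app d)) (IsNormalEpi.of_isIso _))
    (by simp [ConeAt.star])
  refine ⟨η.star (F.map (γ.app d)) (IsNormalEpi.of_isIso _), ?_, fun c => ?_⟩
  · rw [rClass_star_isIso, hη, rClass_star_isIso]
  · change η.app (F.obj c) ≫ F.map (γ.app d) = _
    rw [hηF, ← F.map_comp]
    simp [ConeAt.star]

/-- The cone with vertex `F(z)` induced by a cone with vertex `z`. -/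
noncomputable def IsCC.coneMap (h : IsCC F G) {z : C} (γ : ConeAt C z) : ConeAt D (F.obj z) :=
  (h.exists_coneMap γ).choose

theorem IsCC.rClass_coneMap (h : IsCC F G) {z : C} (γ : ConeAt C z) :
    rClass (⟨_, h.coneMap γ⟩ : Cones D) = G (rClass ⟨z, γ⟩) :=
  (h.exists_coneMap γ).choose_spec.1

theorem IsCC.coneMap_app (h : IsCC F G) {z : C} (γ : ConeAt C z) (c : C) :
    (h.coneMap γ).app (F.obj c) = F.map (γ.app c) :=
  (h.exists_coneMap γ).choose_spec.2 c

theorem IsCC.coneMap_unique (h : IsCC F G) {z : C} (γ : ConeAt C z) (δ : ConeAt D (F.obj z))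
    (hδ : rClass (⟨_, δ⟩ : Cones D) = G (rClass ⟨z, γ⟩))
    (hδF : ∀ c, δ.app (F.obj c) = F.map (γ.app c)) : h.coneMap γ = δ := by
  obtain ⟨d, hd⟩ := γ.exists_isIso
  have hi : IsIso ((h.coneMap γ).app (F.obj d)) := by
    rw [h.coneMap_app]
    infer_instance
  refine ConeAt.eq_of_le (η := h.coneMap γ) le_rfl ?_ (F.obj d) ?_
  · rw [hδ, h.rClass_coneMap]
  · rw [hδF, h.coneMap_app]

/-- Both sides lie below `h.coneMap γ`, the left one by monotonicity of `G`, and they agree at an `F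
d` where that cone is invertible. -/
theorem IsCC.coneMap_star (h : IsCC F G) {z w : C} (γ : ConeAt C z) (p : z ⟶ w)
    (hp : IsNormalEpi p) :
    h.coneMap (γ.star p hp) = (h.coneMap γ).star (F.map p) (h.map_isNormalEpi hp) := by
  obtain ⟨d, hd⟩ := γ.exists_isIso
  have hi : IsIso ((h.coneMap γ).app (F.obj d)) := by
    rw [h.coneMap_app]
    infer_instance
  refine ConeAt.eq_of_le (η := h.coneMap γ) ?_ (rightLE_star _ _ _) (F.obj d) ?_
  · rw [h.rClass_coneMap, h.rClass_coneMap]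
    exact h.mono (rightLE_star γ p hp)
  · rw [h.coneMap_app]
    change F.map (γ.app d ≫ p) = (h.coneMap γ).app (F.obj d) ≫ F.map p
    rw [h.coneMap_app, F.map_comp]

/-- The map of cones induced by a CC-morphism. -/
noncomputable def IsCC.onCones (h : IsCC F G) (x : Cones C) : Cones D :=
  ⟨F.obj x.vertex, h.coneMap x.cone⟩

theorem IsCC.isCanonical_map (h : IsCC F G) {a b z : C} {f : a ⟶ b} {p : a ⟶ z} {j : z ⟶ b}
    (hf : IsCanonical f p j) : IsCanonical (F.map f) (F.map p) (F.map j) :=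
  ⟨h.map_isNormalEpi hf.1, h.map_incl j hf.2.1, by rw [hf.2.2, F.map_comp]⟩

theorem IsCC.onCones_act (h : IsCC F G) (x : Cones C) {c : C} (f : x.vertex ⟶ c) :
    h.onCones (x.act f) = (h.onCones x).act (F.map f) := by
  refine Eq.trans ?_ (Cones.act_eq (h.onCones x) (h.isCanonical_map (isCanonical f))).symm
  exact congrArg (Cones.mk _) (h.coneMap_star _ _ (isCanonical f).1)

/-- The homomorphism of semigroups of cones induced by a CC-morphism. -/
noncomputable def IsCC.coneHom (h : IsCC F G) : Cones C →ₙ* Cones D where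
  toFun := h.onCones
  map_mul' x y := by
    rw [Cones.mul_eq_act, h.onCones_act, ← h.coneMap_app]
    rfl

theorem IsCC.coneHom_id (h : IsCC (𝟭 C) id) : h.coneHom = MulHom.id (Cones C) := by
  ext x
  exact congrArg (Cones.mk x.vertex) (h.coneMap_unique x.cone x.cone rfl fun _ => rfl)

theorem IsCC.coneHom_comp {H : D ⥤ E} {K : RClass (Cones D) → RClass (Cones E)} (h : IsCC F G)
    (k : IsCC H K) (l : IsCC (F ⋙ H) (K ∘ G)) : l.coneHom = k.coneHom.comp h.coneHom := by
  ext x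
  refine congrArg (Cones.mk (H.obj (F.obj x.vertex)))
    (l.coneMap_unique x.cone (k.coneMap (h.coneMap x.cone)) ?_ fun c => ?_)
  · exact (k.rClass_coneMap _).trans (congrArg K (h.rClass_coneMap _))
  · exact (k.coneMap_app _ _).trans (congrArg H.map (h.coneMap_app x.cone c))

/-- A heterogeneous form of `Cones.act_injective`, needed to compare two functors whose object maps
agree only propositionally. -/
theorem heq_of_act_eq {w w' v v' : C} {α : ConeAt C w} {α' : ConeAt C w'} {f : w ⟶ v}
    {f' : w' ⟶ v'} (h : (⟨w, α⟩ : Cones C) = ⟨w', α'⟩) (hv : v = v')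
    (e : Cones.act ⟨w, α⟩ f = Cones.act ⟨w', α'⟩ f') : HEq f f' := by
  obtain rfl := hv
  obtain rfl : w = w' := congrArg Cones.vertex h
  obtain rfl := Cones.eq_mk_of_eq h
  exact heq_of_eq (Cones.act_injective _ e)

theorem IsCC.eq_of_coneHom_eq {F' : C ⥤ D} {G' : RClass (Cones C) → RClass (Cones D)}
    (h : IsCC F G) (h' : IsCC F' G') (e : h.coneHom = h'.coneHom) : F = F' ∧ G = G' := by
  have e' : ∀ x, h.onCones x = h'.onCones x := fun x => DFunLike.congr_fun e x
  have hobj : ∀ c, F.obj c = F'.obj c := fun c => congrArg Cones.vertex (e' (unitCone c))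
  refine ⟨Functor.hext hobj fun a b f => ?_, ?_⟩
  · refine heq_of_act_eq (e' (unitCone a)) (hobj b) ?_
    exact (h.onCones_act (unitCone a) f).symm.trans
      ((e' _).trans (h'.onCones_act (unitCone a) f))
  · funext d
    obtain ⟨x, rfl⟩ : ∃ x, rClass x = d := Quotient.exists_rep d
    exact (h.rClass_coneMap x.cone).symm.trans
      ((congrArg rClass (e' x)).trans (h'.rClass_coneMap x.cone))

end

/-! ### Every homomorphism of semigroups of cones comes from a CC-morphism -/

section

variable {C D : Type u} [SmallCategory C] [NormalCategory C] [SmallCategory D]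
  [NormalCategory D] (φ : Cones C →ₙ* Cones D)

theorem Cones.act_act_of_eq {x y : Cones C} {c d : C} {f : x.vertex ⟶ c} (h : x.act f = y)
    (j : y.vertex ⟶ c) (hj : incl j) (g : c ⟶ d) : y.act (j ≫ g) = x.act (f ≫ g) := by
  subst h
  exact x.act_act f j hj g

/-- Subobjects are membership in left ideals, which any homomorphism respects. -/
theorem map_isSubobject {x y : Cones C} (h : IsSubobject x.vertex y.vertex) :
    IsSubobject (φ x).vertex (φ y).vertex := by
  obtain ⟨s, rfl⟩ := Cones.mem_leftIdeal_iff.2 h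
  rw [map_mul]
  exact Cones.mul_vertex _ _

/-- The object map induced by a homomorphism of semigroups of cones. -/
noncomputable abbrev homObj (c : C) : D := (φ (unitCone c)).vertex

theorem vertex_map_eq (x : Cones C) : (φ x).vertex = homObj φ x.vertex :=
  IsSubobject.antisymm
    (map_isSubobject φ (y := unitCone x.vertex) ⟨𝟙 x.vertex, incl_id _⟩)
    (map_isSubobject φ (x := unitCone x.vertex) ⟨𝟙 x.vertex, incl_id _⟩)

theorem exists_homMap {c d : C} (f : c ⟶ d) : ∃ g : homObj φ c ⟶ homObj φ d,
    ∀ (x : Cones C) (k : x.vertex ⟶ c) (l : (φ x).vertex ⟶ homObj φ c), incl k → incl l →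
      (φ x).act (l ≫ g) = φ (x.act (k ≫ f)) := by
  obtain ⟨j, hj⟩ : IsSubobject (φ ((unitCone c).act f)).vertex (homObj φ d) :=
    map_isSubobject φ (y := unitCone d) ((unitCone c).act_vertex f)
  -- Acting by this component is multiplying by the image of the cone recording `f`. Allowing every
  -- `x` with vertex in `c`, not only the unit cone, is what makes composition work.
  refine ⟨(φ ((unitCone c).act f)).cone.app _ ≫ j, fun x k l hk hl => ?_⟩
  rw [← Category.assoc, Cones.act_comp_incl _ _ _ hj, Cones.act_app _ _ _ hl, ← map_mul,
    Cones.mul_act]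
  congr 2
  change (unitConeAt c).app x.vertex ≫ f = k ≫ f
  rw [← (unitConeAt c).incl_app k hk, unitConeAt_app, Category.comp_id]

/-- The morphism map induced by a homomorphism of semigroups of cones. -/
noncomputable def homMap {c d : C} (f : c ⟶ d) : homObj φ c ⟶ homObj φ d :=
  (exists_homMap φ f).choose

theorem act_incl_homMap {c d : C} (f : c ⟶ d) (x : Cones C) (k : x.vertex ⟶ c)
    (l : (φ x).vertex ⟶ homObj φ c) (hk : incl k) (hl : incl l) :
    (φ x).act (l ≫ homMap φ f) = φ (x.act (k ≫ f)) :=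
  (exists_homMap φ f).choose_spec x k l hk hl

theorem act_homMap {c d : C} (f : c ⟶ d) :
    (φ (unitCone c)).act (homMap φ f) = φ ((unitCone c).act f) := by
  have := act_incl_homMap φ f (unitCone c) (𝟙 c) (𝟙 _) (incl_id _) (incl_id _)
  rwa [Category.id_comp, Category.id_comp] at this

/-- The functor induced by a homomorphism of semigroups of cones. -/
noncomputable def homFunctor : C ⥤ D where
  obj := homObj φ
  map := homMap φ
  map_id c := by
    refine Cones.act_injective (φ (unitCone c)) ((act_homMap φ (𝟙 c)).trans ?_)
    rw [Cones.act_incl (unitCone c) (𝟙 c) (incl_id c)]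
    exact (Cones.act_incl (φ (unitCone c)) (𝟙 _) (incl_id _)).symm
  map_comp {a b c} f g := by
    refine Cones.act_injective (φ (unitCone a)) ((act_homMap φ (f ≫ g)).trans ?_)
    obtain ⟨k, hk⟩ := (unitCone a).act_vertex f
    obtain ⟨l, hl⟩ : IsSubobject (φ ((unitCone a).act f)).vertex (homObj φ b) :=
      map_isSubobject φ (y := unitCone b) ⟨k, hk⟩
    refine Eq.trans ?_ (Cones.act_act_of_eq (act_homMap φ f) l hl _)
    rw [act_incl_homMap φ g _ k l hk hl,
      Cones.act_act _ _ _ hk]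

/-- Both morphisms carry the image of the unit cone at `c` to the image of its product with `x`. -/
theorem app_map_eq (x : Cones C) {δ : ConeAt D (homObj φ x.vertex)}
    (h : φ x = ⟨_, δ⟩) (c : C) : δ.app (homObj φ c) = homMap φ (x.cone.app c) := by
  refine Cones.act_injective (φ (unitCone c)) ?_
  rw [act_homMap]
  refine Eq.trans ?_ (map_mul φ (unitCone c) x).symm
  rw [h]
  rfl

theorem map_rightLE {x y : Cones C} (h : RightLE x y) : RightLE (φ x) (φ y) := by
  obtain ⟨s, rfl⟩ := h
  exact ⟨φ s, map_mul φ _ _⟩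

/-- The map of R-classes induced by a homomorphism of semigroups of cones. -/
noncomputable def homRClass : RClass (Cones C) → RClass (Cones D) :=
  Quotient.map φ fun _ _ h => ⟨map_rightLE φ h.1, map_rightLE φ h.2⟩

theorem isCC_of_hom : IsCC (homFunctor φ) (homRClass φ) where
  mono := by
    rintro ⟨x⟩ ⟨y⟩ h
    exact map_rightLE φ (x := x) (y := y) h
  map_incl {a b} j hj := by
    obtain ⟨k, hk⟩ : IsSubobject (homObj φ a) (homObj φ b) :=
      map_isSubobject φ (x := unitCone a) (y := unitCone b) ⟨j, hj⟩
    have e : homMap φ j = k := by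
      refine Cones.act_injective (φ (unitCone a)) ((act_homMap φ j).trans ?_)
      rw [Cones.act_incl (unitCone a) j hj]
      exact (Cones.act_incl (φ (unitCone a)) k hk).symm
    change incl (homMap φ j)
    rwa [e]
  map_cone z ε hε := by
    obtain ⟨η, hη⟩ := Cones.exists_eq_mk _ (vertex_map_eq φ ⟨z, ε⟩)
    refine ⟨η, (isIdempotentElem_iff η).1 ?_, congrArg rClass hη.symm,
      fun c => app_map_eq φ ⟨z, ε⟩ hη c⟩
    have := ((isIdempotentElem_iff ε).2 hε).map φ
    rwa [hη] at this

theorem coneHom_isCC_of_hom : (isCC_of_hom φ).coneHom = φ := by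
  ext x
  obtain ⟨δ, hδ⟩ := Cones.exists_eq_mk _ (vertex_map_eq φ x)
  rw [hδ]
  exact congrArg (Cones.mk _) ((isCC_of_hom φ).coneMap_unique x.cone δ (congrArg rClass hδ.symm)
    fun c => app_map_eq φ x hδ c)

end

/-! ### The equivalence of categories -/

section

variable {C D : NormalCat.{u}}

/-- The map of R-classes of a CC-morphism between normal categories. -/
noncomputable def mapRClass (f : C ⟶ D) (d : RClass (Cones C.carrier)) : RClass (Cones D.carrier) :=
  (CCMorphism.map f ⟨d, trivial⟩).1

/-- The functor of a CC-morphism between normal categories. -/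
noncomputable def functorOf (f : C ⟶ D) : C.carrier ⥤ D.carrier := CCMorphism.functor f

theorem IsConnectedBy.cone_idem {C : Type u} [SmallCategory C] [NormalCategory C] {c : C}
    {d : RClass (Cones C)} (h : IsConnectedBy c d) : IsIdempotentElem (⟨c, h.cone⟩ : Cones C) :=
  h.choose_spec.1

theorem IsConnectedBy.rClass_cone {C : Type u} [SmallCategory C] [NormalCategory C] {c : C}
    {d : RClass (Cones C)} (h : IsConnectedBy c d) : rClass (⟨c, h.cone⟩ : Cones C) = d :=
  h.choose_spec.2

theorem IsConnectedBy.cone_eq {C : Type u} [SmallCategory C] [NormalCategory C] {c : C}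
    {d : RClass (Cones C)} (h : IsConnectedBy c d) (ε : ConeAt C c) (hε : ε.app c = 𝟙 c)
    (hd : rClass (⟨c, ε⟩ : Cones C) = d) : h.cone = ε :=
  idempotent_unique _ _ h.cone_idem ((isIdempotentElem_iff ε).2 hε) (h.rClass_cone.trans hd.symm)

theorem isCC_of_ccMorphism (f : C ⟶ D) : IsCC (functorOf f) (mapRClass f) where
  mono _ _ h := (CCMorphism.map f).monotone h
  map_incl := CCMorphism.map_incl f
  map_cone z ε hε := by
    have h : IsConnectedBy z (rClass ⟨z, ε⟩) := ⟨ε, (isIdempotentElem_iff ε).2 hε, rfl⟩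
    have h' : IsConnectedBy ((functorOf f).obj z) (mapRClass f (rClass ⟨z, ε⟩)) :=
      CCMorphism.connected f z ⟨_, trivial⟩ h
    refine ⟨h'.cone, (isIdempotentElem_iff _).1 h'.cone_idem, h'.rClass_cone, fun c => ?_⟩
    have := CCMorphism.map_cone f z ⟨_, trivial⟩ h c
    exact this.symm.trans (congrArg (fun k : ConeAt C.carrier z => (functorOf f).map (k.app c))
      (h.cone_eq ε hε rfl))

/-- The CC-morphism between normal categories determined by a functor and a map of R-classes. -/
noncomputable def ccMorphismOf {F : C.carrier ⥤ D.carrier}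
    {G : RClass (Cones C.carrier) → RClass (Cones D.carrier)} (h : IsCC F G) : C ⟶ D :=
  -- The chosen idempotent cone has R-class `d` only propositionally; the rewriting is done once
  -- here.
  have key : ∀ (c : C.carrier) (d : RClass (Cones C.carrier)) (hc : IsConnectedBy c d),
      ∃ η : ConeAt D.carrier (F.obj c), η.app (F.obj c) = 𝟙 _ ∧ rClass ⟨_, η⟩ = G d ∧
        ∀ c', η.app (F.obj c') = F.map (hc.cone.app c') := fun c d hc => by
    have := h.map_cone c hc.cone ((isIdempotentElem_iff _).1 hc.cone_idem)
    rwa [hc.rClass_cone] at this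
  { functor := F
    map := ⟨fun d => ⟨G d.1, trivial⟩, fun _ _ hd => h.mono hd⟩
    map_incl := h.map_incl
    connected := fun c d hc => by
      obtain ⟨η, h1, h2, -⟩ := key c d.1 hc
      exact ⟨η, (isIdempotentElem_iff η).2 h1, h2⟩
    map_cone := fun c d hc c' => by
      obtain ⟨η, h1, h2, h3⟩ := key c d.1 hc
      have hc' : IsConnectedBy (F.obj c) (G d.1) := ⟨η, (isIdempotentElem_iff η).2 h1, h2⟩
      have e : hc'.cone = η := hc'.cone_eq η h1 h2
      exact (h3 c').symm.trans (congrArg (fun k : ConeAt D.carrier (F.obj c) =>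
        k.app (F.obj c')) e.symm) }

end

/-- The functor sending a normal category to its semigroup of cones. -/
noncomputable def coneFunctor : NormalCat.{u} ⥤ Semigrp.{u} where
  obj C := Semigrp.of (Cones C.carrier)
  map f := Semigrp.ofHom (isCC_of_ccMorphism f).coneHom
  map_id C := congrArg Semigrp.ofHom (IsCC.coneHom_id (isCC_of_ccMorphism (𝟙 C)))
  map_comp f g := congrArg Semigrp.ofHom
    (IsCC.coneHom_comp (isCC_of_ccMorphism f) (isCC_of_ccMorphism g) (isCC_of_ccMorphism (f ≫ g)))

instance : coneFunctor.{u}.Faithful where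
  map_injective {_ _ f g} h := by
    obtain ⟨h1, h2⟩ := IsCC.eq_of_coneHom_eq (isCC_of_ccMorphism f) (isCC_of_ccMorphism g)
      (congrArg Semigrp.Hom.hom h)
    refine CCMorphism.ext h1 (OrderHom.ext _ _ (funext fun d => Subtype.ext ?_))
    exact congrFun h2 d.1

instance : coneFunctor.{u}.Full where
  map_surjective φ := ⟨ccMorphismOf (isCC_of_hom φ.hom),
    Semigrp.hom_ext (coneHom_isCC_of_hom φ.hom)⟩

/-- The semigroup of cones, as a functor to totally left reductive semigroups. -/
noncomputable def coneFunctorTLR : NormalCat.{u} ⥤ TotallyLeftReductiveSemigrp.{u} :=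
  IsTotallyLeftReductive.lift coneFunctor fun C => isTotallyLeftReductive_cones C.carrier

instance : coneFunctorTLR.{u}.Faithful :=
  Functor.Faithful.of_comp_iso (ObjectProperty.liftCompιIso _ coneFunctor _)

instance : coneFunctorTLR.{u}.Full :=
  Functor.Full.of_comp_faithful_iso (ObjectProperty.liftCompιIso _ coneFunctor _)

instance : coneFunctorTLR.{u}.EssSurj where
  mem_essImage S := by
    obtain ⟨hS, ⟨e⟩⟩ := S.property
    -- The preimage is the category of principal left ideals, and the isomorphism is the one in the
    -- definition.
    exact ⟨⟨LeftCat S.obj⟩, ⟨IsTotallyLeftReductive.isoMk e.symm.toSemigrpIso⟩⟩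

instance : coneFunctorTLR.{u}.IsEquivalence where

end ConnCat

theorem theorem7 :
    Nonempty (ConnCat.NormalCat.{u} ≌ ConnCat.TotallyLeftReductiveSemigrp.{u}) :=
  ⟨ConnCat.coneFunctorTLR.asEquivalence⟩
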